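/- **Setting.** For $L>0$ let $\mathcal T_L=[0,L]^3$ be the periodic torus, and let $H_L$ be the space of mean-zero, (distributionally) divergence-free vector fields $u\in L^2(\mathcal T_L;\mathbb R^3)$ with $|u|_{H_L}^2=L^{-3}\int_{\mathcal T_L}\|u\|^2dx$. Let $D(A_L)=H_L\cap H^2$ be the domain of the Stokes operator $A_L=-\Delta$, and write $u(x)=\sum_k\hat u(k)e^{-ik\cdot x}$, $k=\frac{2\pi}{L}m$, $m\in\mathbb Z^3\setminus\{0\}$. Let $\mathcal P_L$ be the set of probability measures $\mu$ on $H_L$ with $\mu(D(A_L))=1$ and $\mu[\int\|Du\|^2dx]<\infty$ that are invariant under translations and discretely isotropic: $u(R\,\cdot)$ and $Ru(\cdot)$ have the same law for every rotation $R$ that maps the set of coordinate axes to itself. Let $\sigma_m$ $(m\in\mathbb Z^3\setminus\{0\})$ be complex $3\times3$ matrices with $m\cdot\sigma_m=0$, $\overline{\sigma_m}=\sigma_{-m}$, $|\sigma_{Rm}|=|\sigma_m|$ (Hilbert–Schmidt norm) for all such $R$, $\sum|\sigma_m|^2<\infty$ and $\sum|m|^2|\sigma_m|^2<\infty$. Let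 $\beta_m$ be standard three-dimensional complex Brownian motions ($E|\beta_m^j(t)|^2=t$) with $\beta_{-m}=\overline{\beta_m}$ and otherwise independent. For $\nu,L>0$ and $n\in\mathbb N$ consider the Galerkin approximation, on the modes $k=\frac{2\pi}{L}m$ with $0<|m|\le n$, of the stochastic Navier–Stokes equations on $\mathcal T_L$, $$du+[\nu A_Lu+\pi^{(n)}_LB_L(u,u)]\,dt=\sum_{0<|m|\le n}\sigma_m\,d\beta_m\,e^{-i\frac{2\pi}{L}m\cdot x},$$ where $B_L(u,u)$ is the divergence-free part of $(u\cdot\nabla)u$ and $\pi_L^{(n)}$ is the orthogonal projection onto these modes. Let $\mathcal S^n(\nu,L)$ be the set of its invariant measures that belong to $\mathcal P_L$, and let $\mathcal P^G_{NS}(\nu,L)$ be the set of all probability measures on $H_L$ that are weak limits of some $\mu_j\in\mathcal S^{k_j}(\nu,L)$ with $k_j\to\infty$. Put $$\mathcal P^G_{NS}=\{(\mu,\nu):\mu\in\mathcal P^G_{NS}(\nu,1)\},\qquad \tilde{\mathcal P}^G_{NS}=\{(\mu,\tilde\nu,L):\mu\in\mathcal P^G_{NS}(\tilde\nu,L)\}.$$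 Fix a coordinate unit vector $e$ and let $S_2^\mu(r)=\mu[\|u(re)-u(0)\|^2]\in[0,\infty]$, where $u$ is evaluated through its continuous representative. **K41 scaling law.** A set $\mathcal M$ of pairs $(\mu,\nu)$ has a scaling law of K41 type if there are $\nu_0>0$, $C>c>0$, $C_0>0$ and a monotone function $R_0:(0,\nu_0]\to\mathbb R_+$ with $R_0>C_0$ and $R_0(\nu)\to\infty$ as $\nu\to0$ such that $c\,r^{2/3}\le S_2^\mu(r)\le C\,r^{2/3}$ for all $(\mu,\nu)\in\mathcal M$ with $\nu\in(0,\nu_0]$ and all $r$ with $C_0\nu^{3/4}<r<\nu^{3/4}R_0(\nu)$. **Condition A.** A set $\tilde{\mathcal M}$ of triples $(\mu,\tilde\nu,L)$ satisfies Condition A if there are $C>c>0$ and an admissible region $$D=\{(\tilde\nu,L):0<\tilde\nu<\tilde\nu_0,\ L>\tilde R_0(\tilde\nu)\},$$ where $\tilde\nu_0>0$ and $\tilde R_0:(0,\tilde\nu_0]\to[1,\infty)$ is strictly decreasing with $\tilde R_0(\tilde\nu)\to\infty$ as $\tilde\nu\to0$, such that $c\le\mu[\|u(e)-u(0)\|^2]\le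 C$ for all $(\mu,\tilde\nu,L)\in\tilde{\mathcal M}$ with $(\tilde\nu,L)\in D$. **Proposition.** $\tilde{\mathcal P}^G_{NS}$ satisfies Condition A if and only if $\mathcal P^G_{NS}$ has a scaling law of K41 type. -/

import Mathlib

open MeasureTheory ProbabilityTheory Filter Topology
open scoped NNReal ENNReal BoundedContinuousFunction

noncomputable section

namespace StochNS

/-! ### Tori and fields -/

/-- The set `ℝ₊` of positive real numbers. -/
abbrev PosReal : Type := {x : ℝ // 0 < x}

instance instFactPos (L : PosReal) : Fact (0 < (L : ℝ)) := ⟨L.2⟩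

/-- The torus `[0,L]³` with periodic identification. -/
abbrev Torus (L : PosReal) : Type := Fin 3 → AddCircle (L : ℝ)

/-- Normalised Lebesgue measure `L⁻³ dx` on the torus. -/
def torusMeasure (L : PosReal) : Measure (Torus L) :=
  Measure.pi fun _ => AddCircle.haarAddCircle

instance instProbTorus (L : PosReal) : IsProbabilityMeasure (torusMeasure L) := by
  unfold torusMeasure; infer_instance

instance instHaarTorus (L : PosReal) : (torusMeasure L).IsAddHaarMeasure := by
  unfold torusMeasure; infer_instance

/-- Velocity vectors, with the Euclidean norm. -/
abbrev Vel : Type := EuclideanSpace ℝ (Fin 3)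

/-- Square integrable vector fields on the torus, with norm `|u|² = L⁻³ ∫ ‖u(x)‖² dx`. -/
abbrev L2 (L : PosReal) : Type := Lp Vel 2 (torusMeasure L)

instance instMeasurableL2 (L : PosReal) : MeasurableSpace (L2 L) := borel _

instance instBorelL2 (L : PosReal) : BorelSpace (L2 L) := ⟨rfl⟩

/-- Wave numbers are `k = (2π/L) m`, and are indexed by `m ∈ ℤ³`. -/
abbrev Mode : Type := Fin 3 → ℤ

/-- The wave vector `k = (2π/L) m`. -/
def waveVec (L : PosReal) (m : Mode) : Fin 3 → ℝ := fun j => 2 * Real.pi / L * m j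

/-- `|k|²` for the wave vector `k = (2π/L) m`. -/
def waveSq (L : PosReal) (m : Mode) : ℝ := ∑ j, waveVec L m j ^ 2

/-- The character `e^{i k·x}`, `k = (2π/L) m`. -/
def character (L : PosReal) (m : Mode) (x : Torus L) : ℂ := ∏ j, fourier (m j) (x j)

/-- The Fourier coefficient `û(k) = L⁻³ ∫ e^{i k·x} u(x) dx ∈ ℂ³`, so that
`u(x) = ∑ₖ û(k) e^{-i k·x}`. -/
def fourierCoeffVec {L : PosReal} (u : L2 L) (m : Mode) : Fin 3 → ℂ :=
  fun j => ∫ x, character L m x * ((u x j : ℝ) : ℂ) ∂torusMeasure L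

/-- The energy space `H_L`: square integrable fields with zero mean and zero distributional
divergence on the torus (the divergence being tested against all characters). -/
def H (L : PosReal) : Set (L2 L) :=
  {u | ∫ x, u x ∂torusMeasure L = 0 ∧
    ∀ m : Mode, ∑ j, (waveVec L m j : ℂ) * fourierCoeffVec u m j = 0}

/-- `∑ₖ |k|^{2s} ‖û(k)‖²`. For `s = 1` this is `L⁻³ ∫ ‖Du‖²`, for `s = 2` it is `L⁻³ ∫ ‖Δu‖²`;
it is infinite when `u` is not in the Sobolev space of order `s`. -/
def sobolevSq {L : PosReal} (s : ℕ) (u : L2 L) : ℝ≥0∞ :=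
  ∑' m : Mode, ENNReal.ofReal (waveSq L m ^ s * ∑ j, ‖fourierCoeffVec u m j‖ ^ 2)

/-- The domain `D(A_L)` of the Stokes operator, that is, the fields of `H_L` of class `H²`. -/
def domA (L : PosReal) : Set (H L) := {u | sobolevSq 2 (u : L2 L) < ∞}

/-! ### The class `𝒫_L` of measures -/

/-- The translated field `u(· - a)`. -/
def translate {L : PosReal} (a : Torus L) (u : L2 L) : L2 L :=
  Lp.compMeasurePreserving (fun x => x - a) (measurePreserving_sub_right (torusMeasure L) a) u

/-- The rotations of `ℝ³` that map the set of coordinate axes to itself: these are exactly the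
orthogonal matrices with integer entries and determinant `1`. -/
abbrev AxisRotation : Type := Matrix.specialOrthogonalGroup (Fin 3) ℤ

/-- The action of an axis rotation on the torus. -/
def rotTorus (L : PosReal) (R : Matrix (Fin 3) (Fin 3) ℤ) : Torus L →+ Torus L where
  toFun x := fun i => ∑ j, R i j • x j
  map_zero' := by ext i; simp
  map_add' x y := by ext i; simp [Finset.sum_add_distrib]

lemma rotTorus_comp (L : PosReal) (R S : Matrix (Fin 3) (Fin 3) ℤ) (x : Torus L) :
    rotTorus L R (rotTorus L S x) = rotTorus L (R * S) x := by
  ext i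
  simp only [rotTorus, AddMonoidHom.coe_mk, ZeroHom.coe_mk, Matrix.mul_apply, Finset.smul_sum,
    Finset.sum_smul, mul_smul]
  rw [Finset.sum_comm]

lemma rotTorus_one (L : PosReal) (x : Torus L) : rotTorus L 1 x = x := by
  ext i
  simp [rotTorus, Matrix.one_apply]

lemma rotTorus_measurePreserving (L : PosReal) (R : AxisRotation) :
    MeasurePreserving (rotTorus L R.1) (torusMeasure L) (torusMeasure L) := by
  refine AddMonoidHom.measurePreserving ?_ ?_ rfl
  · change Continuous fun x : Torus L => fun i => ∑ j, R.1 i j • x j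
    fun_prop
  · intro x
    refine ⟨rotTorus L R.1.transpose x, ?_⟩
    rw [rotTorus_comp]
    have h := (Matrix.mem_orthogonalGroup_iff (Fin 3) ℤ).1
      (Matrix.mem_specialOrthogonalGroup_iff.1 R.2).1
    have h' : R.1 * R.1.transpose = 1 := h
    rw [h', rotTorus_one]

/-- The field `u(R ·)`. -/
def rotArg {L : PosReal} (R : AxisRotation) (u : L2 L) : L2 L :=
  Lp.compMeasurePreserving (rotTorus L R.1) (rotTorus_measurePreserving L R) u

/-- The field `R u(·)`. -/
def rotVal {L : PosReal} (R : AxisRotation) (u : L2 L) : L2 L :=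
  (Matrix.toEuclideanCLM (n := Fin 3) (𝕜 := ℝ) (R.1.map (Int.cast : ℤ → ℝ))).compLp u

/-- The class `𝒫_L` of probability measures on `H_L` that are concentrated on `D(A_L)`, have a
finite second moment in `V_L`, are space homogeneous and are partially (discretely) isotropic.
The fields `u(R ·)` and `R u(·)` need not be divergence free, so their laws are compared
on `L²`. -/
structure IsRegularSymmetric {L : PosReal} (μ : ProbabilityMeasure (H L)) : Prop where
  domA : (μ : Measure (H L)) (domA L) = 1
  moment : ∫⁻ u : H L, sobolevSq 1 (u : L2 L) ∂(μ : Measure (H L)) < ∞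
  homogeneous : ∀ (a : Torus L) (f : L2 L →ᵇ ℝ),
    ∫ u : H L, f (translate a (u : L2 L)) ∂(μ : Measure (H L))
      = ∫ u : H L, f (u : L2 L) ∂(μ : Measure (H L))
  isotropic : ∀ (R : AxisRotation) (f : L2 L →ᵇ ℝ),
    ∫ u : H L, f (rotArg R (u : L2 L)) ∂(μ : Measure (H L))
      = ∫ u : H L, f (rotVal R (u : L2 L)) ∂(μ : Measure (H L))

/-! ### The noise -/

/-- Squared Hilbert--Schmidt norm `|σ|²` of a complex `3 × 3` matrix. -/
def matNormSq (M : Matrix (Fin 3) (Fin 3) ℂ) : ℝ := ∑ i, ∑ j, ‖M i j‖ ^ 2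

/-- The standing assumptions on the noise coefficients `σ_m`. The coefficient `σ_m` belongs
to the wave number `2πm` on the unit torus and to `2πm/L` on the torus of side `L`.
The value at `m = 0` is never used. -/
structure IsNoiseCoeff (σ : Mode → Matrix (Fin 3) (Fin 3) ℂ) : Prop where
  divFree : ∀ m ≠ 0, Matrix.vecMul (fun i => (m i : ℂ)) (σ m) = 0
  summable : Summable fun m : Mode => matNormSq (σ m)
  hermitian : ∀ m ≠ 0, (σ m).map (starRingEnd ℂ) = σ (-m)
  isotropic : ∀ m ≠ 0, ∀ R : AxisRotation, matNormSq (σ m) = matNormSq (σ (R.1.mulVec m))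
  summable_grad : Summable fun m : Mode => waveSq 1 m * matNormSq (σ m)

/-- Real part (`false`) or imaginary part (`true`) of a complex number. -/
def part (b : Bool) (z : ℂ) : ℝ := if b then z.im else z.re

/-- The driving family `(β_m)`: three-dimensional complex Brownian motions, normalised so that
`E |β_m^j(t)|² = t`, that satisfy the reality constraint `β_{-m} = conj β_m` and are independent
otherwise, that is, along every set of modes without opposite pairs. -/
structure IsDrivingFamily {Ω : Type} [MeasurableSpace Ω] (P : Measure Ω)
    (β : Mode → ℝ≥0 → Ω → Fin 3 → ℂ) : Prop where
  measurable : ∀ m t, Measurable (β m t)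
  reality : ∀ m t ω j, β (-m) t ω j = starRingEnd ℂ (β m t ω j)
  brownian : ∀ m ≠ 0, ∀ (j : Fin 3) (b : Bool),
    IsBrownianReal (fun t ω => Real.sqrt 2 * part b (β m t ω j)) P
  indep : ∀ S : Set Mode, (∀ m ∈ S, -m ∉ S) →
    iIndepFun (fun (i : S × Fin 3 × Bool) ω (t : ℝ≥0) => part i.2.2 (β i.1 t ω i.2.1)) P

/-! ### Galerkin approximations -/

/-- The modes `m` of the `n`-th Galerkin approximation: `0 < |m| ≤ n`, equivalently
`0 < |k| ≤ (2π/L) n`. -/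
def modes (n : ℕ) : Finset Mode :=
  (Fintype.piFinset fun _ => Finset.Icc (-(n : ℤ)) n).filter fun m =>
    0 < ∑ j, m j ^ 2 ∧ ∑ j, m j ^ 2 ≤ (n : ℤ) ^ 2

/-- Projection of `v ∈ ℂ³` onto the orthogonal complement of `m ≠ 0`. -/
def leray (m : Mode) (v : Fin 3 → ℂ) : Fin 3 → ℂ :=
  fun i => v i - (∑ j, (m j : ℂ) * v j) / (∑ j, (m j : ℂ) ^ 2) * (m i : ℂ)

/-- The Fourier coefficient at `m` of `(u · ∇)u`, for a field `u` with modes in `modes n`: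
`∑_{h + l = m} (-i k_l · û(h)) û(l)`. -/
def convection {L : PosReal} (n : ℕ) (u : L2 L) (m : Mode) : Fin 3 → ℂ :=
  ∑ h ∈ modes n, ∑ l ∈ modes n, if h + l = m then
    (-Complex.I * ∑ j, (waveVec L l j : ℂ) * fourierCoeffVec u h j) • fourierCoeffVec u l
  else 0

/-- The Fourier coefficient at `m` of the drift `ν A_L u + π⁽ⁿ⁾ B_L(u,u)`. -/
def drift {L : PosReal} (ν : PosReal) (n : ℕ) (u : L2 L) (m : Mode) : Fin 3 → ℂ :=
  ((ν : ℂ) * (waveSq L m : ℂ)) • fourierCoeffVec u m + leray m (convection n u m)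

/-- `u` solves, in integral form and mode by mode, the Galerkin equation
`du + [ν A_L u + π⁽ⁿ⁾ B_L(u,u)] dt = ∑_{m ∈ modes n} σ_m dβ_m e^{-i k·x}` in `H_L⁽ⁿ⁾`. -/
structure IsGalerkinSolution (σ : Mode → Matrix (Fin 3) (Fin 3) ℂ) {L : PosReal} (ν : PosReal)
    (n : ℕ) {Ω : Type} [MeasurableSpace Ω] (P : Measure Ω) (β : Mode → ℝ≥0 → Ω → Fin 3 → ℂ)
    (u : ℝ≥0 → Ω → H L) : Prop where
  measurable : ∀ t, Measurable (u t)
  continuous : ∀ᵐ ω ∂P, Continuous fun t => u t ω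
  galerkin : ∀ᵐ ω ∂P, ∀ t, ∀ m ∉ modes n, fourierCoeffVec (u t ω : L2 L) m = 0
  equation : ∀ᵐ ω ∂P, ∀ t : ℝ≥0, ∀ m ∈ modes n,
    fourierCoeffVec (u t ω : L2 L) m
        + ∫ s in (0 : ℝ)..t, drift ν n (u s.toNNReal ω : L2 L) m
      = fourierCoeffVec (u 0 ω : L2 L) m + (σ m).mulVec (β m t ω)

/-- `μ` is an invariant measure of the `n`-th Galerkin equation: the solution started from a
random initial condition of law `μ`, independent of the noise, has law `μ` at all times. -/
def IsGalerkinInvariant (σ : Mode → Matrix (Fin 3) (Fin 3) ℂ) {L : PosReal} (ν : PosReal)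
    (n : ℕ) (μ : ProbabilityMeasure (H L)) : Prop :=
  ∃ (Ω : Type) (_ : MeasurableSpace Ω) (P : Measure Ω) (_ : IsProbabilityMeasure P)
    (β : Mode → ℝ≥0 → Ω → Fin 3 → ℂ) (u : ℝ≥0 → Ω → H L),
    IsDrivingFamily P β ∧ IsGalerkinSolution σ ν n P β u ∧
    IndepFun (u 0) (fun ω m t => β m t ω) P ∧
    ∀ t, P.map (u t) = (μ : Measure (H L))

/-- The set `𝒮ⁿ` of the invariant measures in `𝒫_L` of the `n`-th Galerkin equation. -/
def galerkinStationary (σ : Mode → Matrix (Fin 3) (Fin 3) ℂ) (ν L : PosReal) (n : ℕ) :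
    Set (ProbabilityMeasure (H L)) :=
  {μ | IsRegularSymmetric μ ∧ IsGalerkinInvariant σ ν n μ}

/-- The set `𝒫_NS^G(ν, L)` of Galerkin-limit stationary measures: weak limits on `H_L` of
`μ_{k_j} ∈ 𝒮^{k_j}` with `k_j → ∞`. -/
def galerkinLimit (σ : Mode → Matrix (Fin 3) (Fin 3) ℂ) (ν L : PosReal) :
    Set (ProbabilityMeasure (H L)) :=
  {μ | ∃ (k : ℕ → ℕ) (m : ℕ → ProbabilityMeasure (H L)), Tendsto k atTop atTop ∧
    (∀ j, m j ∈ galerkinStationary σ ν L (k j)) ∧ Tendsto m atTop (𝓝 μ)}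

/-- Pairs `(μ, ν)`, where `μ` is a probability measure on fields on the unit torus. -/
abbrev Pair : Type := ProbabilityMeasure (H 1) × PosReal

/-- Triples `(μ, ν, L)`, where `μ` is a probability measure on fields on the torus of side `L`. -/
structure Triple : Type where
  /-- side of the torus -/
  L : PosReal
  /-- viscosity -/
  ν : PosReal
  /-- law of the field -/
  μ : ProbabilityMeasure (H L)

/-- All pairs `(μ, ν)` with `μ ∈ 𝒫_NS^G(ν) = 𝒫_NS^G(ν, 1)`. -/
def pairsNS (σ : Mode → Matrix (Fin 3) (Fin 3) ℂ) : Set Pair :=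
  {p | p.1 ∈ galerkinLimit σ p.2 1}

/-- All triples `(μ, ν, L)` with `μ ∈ 𝒫_NS^G(ν, L)`. -/
def triplesNS (σ : Mode → Matrix (Fin 3) (Fin 3) ℂ) : Set Triple :=
  {τ | τ.μ ∈ galerkinLimit σ τ.ν τ.L}

/-! ### Structure function, K41 and Condition A -/

open Classical in
/-- The value `u(x)` of the continuous representative of `u`, which exists on `D(A_L)`
(and `0` if there is none). -/
def evalAt {L : PosReal} (u : L2 L) (x : Torus L) : Vel :=
  if h : ∃ g : C(Torus L, Vel), u =ᵐ[torusMeasure L] g then h.choose x else 0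

/-- The point `r e_i` of the torus. -/
def axisPoint (L : PosReal) (i : Fin 3) (r : ℝ) : Torus L :=
  fun j => ((Pi.single i r : Fin 3 → ℝ) j : AddCircle (L : ℝ))

/-- The second order structure function `S₂^μ(r) = μ[‖u(r e_i) - u(0)‖²] ∈ [0, ∞]`. -/
def structureFun {L : PosReal} (i : Fin 3) (μ : ProbabilityMeasure (H L)) (r : ℝ) : ℝ≥0∞ :=
  ∫⁻ u : H L, ENNReal.ofReal
    (‖evalAt (u : L2 L) (axisPoint L i r) - evalAt (u : L2 L) 0‖ ^ 2) ∂(μ : Measure (H L))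

/-- Scaling law of K41 type for a set of pairs, with `e_i` as coordinate unit vector. A monotone
function `R₀` on `(0, ν₀]` with limit `+∞` at `0` is necessarily nonincreasing. -/
def IsK41 (i : Fin 3) (M : Set Pair) : Prop :=
  ∃ (ν₀ c C C₀ : ℝ) (R₀ : ℝ → ℝ), 0 < ν₀ ∧ 0 < c ∧ c < C ∧ 0 < C₀ ∧
    AntitoneOn R₀ (Set.Ioc 0 ν₀) ∧ (∀ ν ∈ Set.Ioc 0 ν₀, C₀ < R₀ ν) ∧
    Tendsto R₀ (𝓝[>] 0) atTop ∧
    ∀ p ∈ M, (p.2 : ℝ) ≤ ν₀ → ∀ r : ℝ,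
      C₀ * (p.2 : ℝ) ^ (3 / 4 : ℝ) < r → r < (p.2 : ℝ) ^ (3 / 4 : ℝ) * R₀ p.2 →
      ENNReal.ofReal (c * r ^ (2 / 3 : ℝ)) ≤ structureFun i p.1 r ∧
      structureFun i p.1 r ≤ ENNReal.ofReal (C * r ^ (2 / 3 : ℝ))

/-- Admissible regions of pairs `(ν, L)`. -/
def IsAdmissibleRegion (D : Set (PosReal × PosReal)) : Prop :=
  ∃ (ν₀ : ℝ) (R₀ : ℝ → ℝ), 0 < ν₀ ∧ StrictAntiOn R₀ (Set.Ioc 0 ν₀) ∧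
    (∀ ν ∈ Set.Ioc 0 ν₀, 1 ≤ R₀ ν) ∧ Tendsto R₀ (𝓝[>] 0) atTop ∧
    D = {q | (q.1 : ℝ) < ν₀ ∧ R₀ q.1 < (q.2 : ℝ)}

/-- Condition A for a set of triples, with `e = e_i`. -/
def ConditionA (i : Fin 3) (M : Set Triple) : Prop :=
  ∃ (D : Set (PosReal × PosReal)) (c C : ℝ), IsAdmissibleRegion D ∧ 0 < c ∧ c < C ∧
    ∀ τ ∈ M, (τ.ν, τ.L) ∈ D →
      ENNReal.ofReal c ≤ structureFun i τ.μ 1 ∧ structureFun i τ.μ 1 ≤ ENNReal.ofReal C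

end StochNS

end

noncomputable section

namespace StochNS

/-! ### Dilations of the torus -/

/-! The Galerkin equations are covariant under a one-parameter group of rescalings that leaves the
noise coefficients untouched. For `c > 0`, send `u(t, x)` on the torus of side `L` to `c u(c⁻² t,
c⁻³ x)` on the torus of side `L' = c³ L`. Viscous and convective terms are both multiplied by `c⁻¹`
when the viscosity becomes `ν' = c⁴ ν`, and `c β(c⁻² t)` is again a driving family. Since everything
is indexed by integer modes, neither `σ_m` nor the truncation `n` changes. The rescaling is a
homeomorphism of energy spaces that respects the symmetries, so it carries Galerkin limits to
Galerkin limits (`scaleLaw_mem_galerkinLimit`).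

Taking `c = L^{1/3}` from the unit torus gives `S₂^{μ'}(1) = L^{2/3} S₂^μ(1/L)`. Hence bounds at
unit distance for `(ν', L)` are `r^{2/3}` bounds at `r = 1/L` for `ν = L^{-4/3} ν'`
(`structureBounds_iff`). Only a comparison of parameter regions remains. Writing `r = q ν^{3/4}`,
one has `ν' = q^{-4/3}` and `L = (q ν^{3/4})⁻¹`: the lower end of the inertial range corresponds to
the upper bound on `ν'`, and its upper end to the lower bound on `L`. The boundary functions are
converted by generalised inverses, in `isK41_of_conditionA` and `conditionA_of_isK41`. -/

/-- The dilation `x ↦ (L' / L) x` between tori. -/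
def dilation (L L' : PosReal) : Torus L →+ Torus L' where
  toFun x := fun j => AddCircle.equivAddCircle (L : ℝ) L' L.2.ne' L'.2.ne' (x j)
  map_zero' := by ext; simp
  map_add' x y := by ext; simp

lemma dilation_apply (L L' : PosReal) (x : Torus L) (j : Fin 3) :
    dilation L L' x j = AddCircle.equivAddCircle (L : ℝ) L' L.2.ne' L'.2.ne' (x j) := rfl

lemma dilation_dilation (L L' : PosReal) (x : Torus L) :
    dilation L' L (dilation L L' x) = x := by
  ext j
  exact (AddCircle.equivAddCircle (L : ℝ) L' L.2.ne' L'.2.ne').symm_apply_apply (x j)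

lemma continuous_dilation (L L' : PosReal) : Continuous (dilation L L') :=
  continuous_pi fun j =>
    (AddCircle.homeomorphAddCircle (L : ℝ) L' L.2.ne' L'.2.ne').continuous.comp (continuous_apply j)

/-- The dilation as a homeomorphism. -/
def dilationHomeo (L L' : PosReal) : Torus L ≃ₜ Torus L' where
  toFun := dilation L L'
  invFun := dilation L' L
  left_inv := dilation_dilation L L'
  right_inv := dilation_dilation L' L
  continuous_toFun := continuous_dilation L L'
  continuous_invFun := continuous_dilation L' L

lemma measurableEmbedding_dilation (L L' : PosReal) : MeasurableEmbedding (dilation L L') :=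
  (dilationHomeo L L').measurableEmbedding

/-- A continuous surjective homomorphism maps Haar measure to Haar measure, and both sides have
total mass one; no Jacobian appears. -/
lemma measurePreserving_dilation (L L' : PosReal) :
    MeasurePreserving (dilation L L') (torusMeasure L) (torusMeasure L') :=
  AddMonoidHom.measurePreserving (continuous_dilation L L') (dilationHomeo L L').surjective
    (by simp)

lemma dilation_rotTorus (L L' : PosReal) (R : Matrix (Fin 3) (Fin 3) ℤ) (x : Torus L) :
    dilation L L' (rotTorus L R x) = rotTorus L' R (dilation L L' x) := by
  ext i
  simp [dilation_apply, rotTorus]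

/-- The factor `1 / L` in the wave vector absorbs the dilation, so the integer index of a mode is
preserved. -/
lemma character_dilation (L L' : PosReal) (m : Mode) (x : Torus L) :
    character L' m (dilation L L' x) = character L m x := by
  unfold character
  refine Finset.prod_congr rfl fun j _ => ?_
  rw [dilation_apply]
  obtain ⟨y, hy⟩ := QuotientAddGroup.mk_surjective (x j)
  rw [← hy]
  rw [AddCircle.equivAddCircle_apply_mk, fourier_coe_apply, fourier_coe_apply]
  congr 1
  have h1 : ((L : ℝ) : ℂ) ≠ 0 := by exact_mod_cast L.2.ne'
  have h2 : ((L' : ℝ) : ℂ) ≠ 0 := by exact_mod_cast L'.2.ne'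
  push_cast
  field_simp

lemma dilation_axisPoint (L L' : PosReal) (i : Fin 3) (r : ℝ) :
    dilation L L' (axisPoint L i r) = axisPoint L' i (r * ((L : ℝ)⁻¹ * L')) := by
  ext j
  rw [dilation_apply]
  simp only [axisPoint]
  rw [AddCircle.equivAddCircle_apply_mk]
  congr 1
  by_cases h : j = i
  · subst h; simp
  · simp [h]

/-! ### Rescaled fields -/

/-- The field `c u((L / L') ·)` on the torus of side `L'`. -/
def scaleL2 (c : ℝ) (L L' : PosReal) (u : L2 L) : L2 L' :=
  c • Lp.compMeasurePreserving (dilation L' L) (measurePreserving_dilation L' L) u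

lemma coeFn_scaleL2 (c : ℝ) (L L' : PosReal) (u : L2 L) :
    scaleL2 c L L' u =ᵐ[torusMeasure L'] fun x => c • u (dilation L' L x) := by
  filter_upwards [Lp.coeFn_smul c
    (Lp.compMeasurePreserving (dilation L' L) (measurePreserving_dilation L' L) u),
    Lp.coeFn_compMeasurePreserving u (measurePreserving_dilation L' L)] with x h1 h2
  rw [scaleL2, h1, Pi.smul_apply, h2, Function.comp_apply]

lemma continuous_scaleL2 (c : ℝ) (L L' : PosReal) : Continuous (scaleL2 c L L') :=
  (Lp.compMeasurePreservingₗᵢ ℝ (dilation L' L)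
    (measurePreserving_dilation L' L)).continuous.const_smul c

lemma scaleL2_scaleL2 {c : ℝ} (hc : c ≠ 0) (L L' : PosReal) (u : L2 L) :
    scaleL2 c⁻¹ L' L (scaleL2 c L L' u) = u := by
  refine Lp.ext ?_
  filter_upwards [coeFn_scaleL2 c⁻¹ L' L (scaleL2 c L L' u),
    (measurePreserving_dilation L L').quasiMeasurePreserving.ae (coeFn_scaleL2 c L L' u)]
    with x h1 h2
  rw [h1, h2, dilation_dilation, smul_smul, inv_mul_cancel₀ hc, one_smul]

lemma fourierCoeffVec_scaleL2 (c : ℝ) (L L' : PosReal) (u : L2 L) (m : Mode) :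
    fourierCoeffVec (scaleL2 c L L' u) m = (c : ℂ) • fourierCoeffVec u m := by
  ext j
  simp only [fourierCoeffVec, Pi.smul_apply, smul_eq_mul]
  rw [← integral_const_mul, ← (measurePreserving_dilation L' L).integral_comp
    (measurableEmbedding_dilation L' L)]
  refine integral_congr_ae ?_
  filter_upwards [coeFn_scaleL2 c L L' u] with x hx
  rw [hx, character_dilation]
  simp
  ring

lemma integral_scaleL2 (c : ℝ) (L L' : PosReal) (u : L2 L) :
    ∫ x, scaleL2 c L L' u x ∂torusMeasure L' = c • ∫ x, u x ∂torusMeasure L := by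
  rw [← integral_smul, ← (measurePreserving_dilation L' L).integral_comp
    (measurableEmbedding_dilation L' L)]
  exact integral_congr_ae (coeFn_scaleL2 c L L' u)

lemma waveVec_rescale (L L' : PosReal) (m : Mode) (j : Fin 3) :
    waveVec L' m j = (L / L' : ℝ) * waveVec L m j := by
  have := L.2.ne'
  have := L'.2.ne'
  simp only [waveVec]
  field_simp

lemma waveSq_rescale (L L' : PosReal) (m : Mode) :
    waveSq L' m = (L / L' : ℝ) ^ 2 * waveSq L m := by
  simp only [waveSq, Finset.mul_sum]
  refine Finset.sum_congr rfl fun j _ => ?_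
  rw [waveVec_rescale L L']
  ring

lemma scaleL2_mem_H (c : ℝ) (L L' : PosReal) {u : L2 L} (hu : u ∈ H L) :
    scaleL2 c L L' u ∈ H L' := by
  refine ⟨by rw [integral_scaleL2, hu.1, smul_zero], fun m => ?_⟩
  have h := hu.2 m
  rw [fourierCoeffVec_scaleL2]
  calc _ = ((L / L' : ℝ) : ℂ) * c * ∑ j, (waveVec L m j : ℂ) * fourierCoeffVec u m j := by
        rw [Finset.mul_sum]
        refine Finset.sum_congr rfl fun j _ => ?_
        rw [waveVec_rescale L L', Pi.smul_apply, smul_eq_mul, Complex.ofReal_mul]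
        ring
    _ = 0 := by rw [h, mul_zero]

lemma sobolevSq_scaleL2 (s : ℕ) (c : ℝ) (L L' : PosReal) (u : L2 L) :
    sobolevSq s (scaleL2 c L L' u)
      = ENNReal.ofReal ((L / L' : ℝ) ^ (2 * s) * c ^ 2) * sobolevSq s u := by
  simp only [sobolevSq]
  rw [← ENNReal.tsum_mul_left]
  refine tsum_congr fun m => ?_
  rw [← ENNReal.ofReal_mul (by rw [pow_mul]; positivity), fourierCoeffVec_scaleL2, waveSq_rescale L L']
  congr 1
  simp only [Pi.smul_apply, smul_eq_mul, norm_mul, mul_pow, Complex.norm_real, Real.norm_eq_abs,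
    sq_abs, ← Finset.mul_sum]
  ring

lemma translate_scaleL2 (c : ℝ) (L L' : PosReal) (a : Torus L') (u : L2 L) :
    translate a (scaleL2 c L L' u) = scaleL2 c L L' (translate (dilation L' L a) u) := by
  refine Lp.ext ?_
  filter_upwards [Lp.coeFn_compMeasurePreserving (scaleL2 c L L' u)
      (measurePreserving_sub_right (torusMeasure L') a),
    (measurePreserving_sub_right (torusMeasure L') a).quasiMeasurePreserving.ae
      (coeFn_scaleL2 c L L' u),
    coeFn_scaleL2 c L L' (translate (dilation L' L a) u),
    (measurePreserving_dilation L' L).quasiMeasurePreserving.ae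
      (Lp.coeFn_compMeasurePreserving u
        (measurePreserving_sub_right (torusMeasure L) (dilation L' L a)))] with x h1 h2 h3 h4
  rw [translate, h1, Function.comp_apply, h2, h3, translate, h4, Function.comp_apply, map_sub]

lemma rotArg_scaleL2 (c : ℝ) (L L' : PosReal) (R : AxisRotation) (u : L2 L) :
    rotArg R (scaleL2 c L L' u) = scaleL2 c L L' (rotArg R u) := by
  refine Lp.ext ?_
  filter_upwards [Lp.coeFn_compMeasurePreserving (scaleL2 c L L' u)
      (rotTorus_measurePreserving L' R),
    (rotTorus_measurePreserving L' R).quasiMeasurePreserving.ae (coeFn_scaleL2 c L L' u),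
    coeFn_scaleL2 c L L' (rotArg R u),
    (measurePreserving_dilation L' L).quasiMeasurePreserving.ae
      (Lp.coeFn_compMeasurePreserving u (rotTorus_measurePreserving L R))] with x h1 h2 h3 h4
  rw [rotArg, h1, Function.comp_apply, h2, h3, rotArg, h4, Function.comp_apply, dilation_rotTorus]

lemma rotVal_scaleL2 (c : ℝ) (L L' : PosReal) (R : AxisRotation) (u : L2 L) :
    rotVal R (scaleL2 c L L' u) = scaleL2 c L L' (rotVal R u) := by
  refine Lp.ext ?_
  filter_upwards [ContinuousLinearMap.coeFn_compLp (Matrix.toEuclideanCLM (n := Fin 3) (𝕜 := ℝ)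
      (R.1.map (Int.cast : ℤ → ℝ))) (scaleL2 c L L' u),
    coeFn_scaleL2 c L L' u, coeFn_scaleL2 c L L' (rotVal R u),
    (measurePreserving_dilation L' L).quasiMeasurePreserving.ae
      (ContinuousLinearMap.coeFn_compLp (Matrix.toEuclideanCLM (n := Fin 3) (𝕜 := ℝ)
        (R.1.map (Int.cast : ℤ → ℝ))) u)] with x h1 h2 h3 h4
  rw [rotVal, h1, h2, h3, rotVal, h4, map_smul]

lemma evalAt_eq_of_ae_eq {L : PosReal} {u : L2 L} {g : C(Torus L, Vel)}
    (h : u =ᵐ[torusMeasure L] g) (x : Torus L) : evalAt u x = g x := by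
  have hex : ∃ g : C(Torus L, Vel), u =ᵐ[torusMeasure L] g := ⟨g, h⟩
  rw [evalAt, dif_pos hex]
  -- Haar measure charges every nonempty open set, so continuous functions equal almost everywhere
  -- are equal.
  have : (hex.choose : Torus L → Vel) =ᵐ[torusMeasure L] g := hex.choose_spec.symm.trans h
  exact congrFun (Continuous.ae_eq_iff_eq (torusMeasure L) hex.choose.continuous
    g.continuous |>.1 this) x

lemma evalAt_scaleL2 {c : ℝ} (hc : c ≠ 0) (L L' : PosReal) (u : L2 L) (x : Torus L') :
    evalAt (scaleL2 c L L' u) x = c • evalAt u (dilation L' L x) := by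
  have key : ∀ {c : ℝ} {L L' : PosReal} {u : L2 L} {g : C(Torus L, Vel)},
      u =ᵐ[torusMeasure L] g → scaleL2 c L L' u =ᵐ[torusMeasure L']
        (c • g.comp ⟨dilation L' L, continuous_dilation L' L⟩ : C(Torus L', Vel)) := by
    intro c L L' u g hg
    filter_upwards [coeFn_scaleL2 c L L' u,
      (measurePreserving_dilation L' L).quasiMeasurePreserving.ae hg] with x h1 h2
    rw [h1, h2]
    rfl
  by_cases h : ∃ g : C(Torus L, Vel), u =ᵐ[torusMeasure L] g
  · obtain ⟨g, hg⟩ := h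
    rw [evalAt_eq_of_ae_eq hg, evalAt_eq_of_ae_eq (key hg)]
    rfl
  -- Scaling back would turn a continuous representative of the rescaled field into one of `u`;
  -- without any, both values are the default `0`.
  · have h' : ¬ ∃ g : C(Torus L', Vel), scaleL2 c L L' u =ᵐ[torusMeasure L'] g := by
      rintro ⟨g, hg⟩
      have := key (c := c⁻¹) (L' := L) hg
      rw [scaleL2_scaleL2 hc] at this
      exact h ⟨_, this⟩
    rw [evalAt, dif_neg h', evalAt, dif_neg h, smul_zero]

/-! ### Rescaled laws -/

/-- Rescaling of fields as a homeomorphism between energy spaces. -/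
def scaleHomeo {c : ℝ} (hc : c ≠ 0) (L L' : PosReal) : H L ≃ₜ H L' where
  toFun u := ⟨scaleL2 c L L' u, scaleL2_mem_H c L L' u.2⟩
  invFun u := ⟨scaleL2 c⁻¹ L' L u, scaleL2_mem_H c⁻¹ L' L u.2⟩
  left_inv u := Subtype.ext (scaleL2_scaleL2 hc L L' u)
  right_inv u := Subtype.ext (by simpa using scaleL2_scaleL2 (inv_ne_zero hc) L' L (u : L2 L'))
  continuous_toFun := ((continuous_scaleL2 c L L').comp continuous_subtype_val).subtype_mk _
  continuous_invFun := ((continuous_scaleL2 c⁻¹ L' L).comp continuous_subtype_val).subtype_mk _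

@[simp]
lemma coe_scaleHomeo {c : ℝ} (hc : c ≠ 0) (L L' : PosReal) (u : H L) :
    (scaleHomeo hc L L' u : L2 L') = scaleL2 c L L' u := rfl

/-- The law of the rescaled field. -/
def scaleLaw {c : ℝ} (hc : c ≠ 0) (L L' : PosReal) (μ : ProbabilityMeasure (H L)) :
    ProbabilityMeasure (H L') :=
  μ.map (scaleHomeo hc L L').continuous.measurable.aemeasurable

lemma toMeasure_scaleLaw {c : ℝ} (hc : c ≠ 0) (L L' : PosReal) (μ : ProbabilityMeasure (H L)) :
    (scaleLaw hc L L' μ : Measure (H L'))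
      = (μ : Measure (H L)).map (scaleHomeo hc L L').toMeasurableEquiv := rfl

lemma continuous_scaleLaw {c : ℝ} (hc : c ≠ 0) (L L' : PosReal) :
    Continuous (scaleLaw hc L L') :=
  ProbabilityMeasure.continuous_map (scaleHomeo hc L L').continuous

lemma IsRegularSymmetric.scaleLaw {c : ℝ} (hc : c ≠ 0) {L : PosReal} (L' : PosReal)
    {μ : ProbabilityMeasure (H L)} (hμ : IsRegularSymmetric μ) :
    IsRegularSymmetric (scaleLaw hc L L' μ) where
  domA := by
    rw [toMeasure_scaleLaw, MeasurableEquiv.map_apply, ← hμ.domA]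
    congr 1
    ext u
    change sobolevSq 2 (scaleL2 c L L' u) < ∞ ↔ sobolevSq 2 (u : L2 L) < ∞
    have := L.2
    have := L'.2
    rw [sobolevSq_scaleL2, ENNReal.mul_lt_top_iff]
    -- A nonzero finite factor cannot affect finiteness of the Sobolev sum.
    have h0 : ENNReal.ofReal ((L / L' : ℝ) ^ (2 * 2) * c ^ 2) ≠ 0 := by
      rw [Ne, ENNReal.ofReal_eq_zero, not_le]
      positivity
    simp [h0]
    intro h
    simp [h]
  moment := by
    rw [toMeasure_scaleLaw, lintegral_map_equiv]
    change ∫⁻ u : H L, sobolevSq 1 (scaleL2 c L L' u) ∂(μ : Measure (H L)) < ∞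
    simp_rw [sobolevSq_scaleL2]
    rw [lintegral_const_mul' _ _ ENNReal.ofReal_ne_top]
    exact ENNReal.mul_lt_top ENNReal.ofReal_lt_top hμ.moment
  homogeneous a f := by
    rw [toMeasure_scaleLaw, integral_map_equiv, integral_map_equiv]
    have := hμ.homogeneous (dilation L' L a) (f.compContinuous ⟨_, continuous_scaleL2 c L L'⟩)
    simp only [BoundedContinuousFunction.compContinuous_apply, ContinuousMap.coe_mk,
      ← translate_scaleL2] at this
    exact this
  isotropic R f := by
    rw [toMeasure_scaleLaw, integral_map_equiv, integral_map_equiv]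
    have := hμ.isotropic R (f.compContinuous ⟨_, continuous_scaleL2 c L L'⟩)
    simp only [BoundedContinuousFunction.compContinuous_apply, ContinuousMap.coe_mk,
      ← rotArg_scaleL2, ← rotVal_scaleL2] at this
    exact this

lemma structureFun_scaleLaw {c : ℝ} (hc : c ≠ 0) (L L' : PosReal) (i : Fin 3)
    (μ : ProbabilityMeasure (H L)) (r : ℝ) :
    structureFun i (scaleLaw hc L L' μ) r
      = ENNReal.ofReal (c ^ 2) * structureFun i μ (r * ((L' : ℝ)⁻¹ * L)) := by
  simp only [structureFun]
  rw [toMeasure_scaleLaw, lintegral_map_equiv, ← lintegral_const_mul' _ _ ENNReal.ofReal_ne_top]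
  refine lintegral_congr fun u => ?_
  change ENNReal.ofReal (‖evalAt (scaleL2 c L L' u) (axisPoint L' i r)
    - evalAt (scaleL2 c L L' u) 0‖ ^ 2) = _
  rw [← ENNReal.ofReal_mul (sq_nonneg c), evalAt_scaleL2 hc, evalAt_scaleL2 hc,
    dilation_axisPoint, map_zero, ← smul_sub, norm_smul, mul_pow, Real.norm_eq_abs, sq_abs]

/-! ### Rescaled Galerkin equations -/

lemma leray_smul (a : ℂ) (m : Mode) (v : Fin 3 → ℂ) : leray m (a • v) = a • leray m v := by
  ext i
  have h : ∑ j, (m j : ℂ) * (a * v j) = a * ∑ j, (m j : ℂ) * v j := by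
    rw [Finset.mul_sum]
    exact Finset.sum_congr rfl fun j _ => by ring
  simp only [leray, Pi.smul_apply, smul_eq_mul, h]
  ring

lemma convection_scaleL2 (c : ℝ) (L L' : PosReal) (n : ℕ) (u : L2 L) (m : Mode) :
    convection n (scaleL2 c L L' u) m
      = ((c ^ 2 * (L / L') : ℝ) : ℂ) • convection n u m := by
  simp only [convection, Finset.smul_sum]
  refine Finset.sum_congr rfl fun h _ => Finset.sum_congr rfl fun l _ => ?_
  split_ifs
  · have hs : ∑ j, (waveVec L' l j : ℂ) * fourierCoeffVec (scaleL2 c L L' u) h j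
        = ((L / L' : ℝ) : ℂ) * c * ∑ j, (waveVec L l j : ℂ) * fourierCoeffVec u h j := by
      rw [Finset.mul_sum]
      refine Finset.sum_congr rfl fun j _ => ?_
      rw [waveVec_rescale L L', fourierCoeffVec_scaleL2, Pi.smul_apply, smul_eq_mul,
        Complex.ofReal_mul]
      ring
    rw [hs, fourierCoeffVec_scaleL2, smul_smul, smul_smul]
    congr 1
    push_cast
    ring
  · rw [smul_zero]

/-- The exponents 3 and 4 are forced here: convection gains `c² L / L'` and viscosity `c (ν' / ν) (L
/ L')²`, and both must equal `c / c²`, the factor of the time derivative. -/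
lemma drift_scaleL2 {c : ℝ} (hc : 0 < c) {L L' ν ν' : PosReal} (hL : (L' : ℝ) = c ^ 3 * L)
    (hν : (ν' : ℝ) = c ^ 4 * ν) (n : ℕ) (u : L2 L) (m : Mode) :
    drift ν' n (scaleL2 c L L' u) m = c⁻¹ • drift ν n u m := by
  have hL0 := L.2.ne'
  have h1 : (c ^ 2 * (L / L') : ℝ) = c⁻¹ := by
    rw [hL]; field_simp
  have h2 : (ν' * waveSq L' m * c : ℝ) = c⁻¹ * (ν * waveSq L m) := by
    rw [hν, waveSq_rescale L L', hL]; field_simp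
  rw [drift, drift, convection_scaleL2, leray_smul, fourierCoeffVec_scaleL2, h1, smul_smul,
    smul_add, ← Complex.coe_smul c⁻¹, ← Complex.coe_smul c⁻¹, smul_smul]
  congr 2
  exact_mod_cast h2

lemma part_real_mul (b : Bool) (c : ℝ) (z : ℂ) : part b (c * z) = c * part b z := by
  cases b <;> simp [part]

/-- Brownian scaling of a driving family. -/
def scaleNoise {Ω : Type} (c : ℝ≥0) (β : Mode → ℝ≥0 → Ω → Fin 3 → ℂ) :
    Mode → ℝ≥0 → Ω → Fin 3 → ℂ :=
  fun m t ω j => ((c : ℝ) : ℂ) * β m ((c ^ 2)⁻¹ * t) ω j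

/-- Brownian scaling; independence survives because each path is transformed by the same measurable
map. -/
lemma IsDrivingFamily.scaleNoise {Ω : Type} [MeasurableSpace Ω] {P : Measure Ω}
    {β : Mode → ℝ≥0 → Ω → Fin 3 → ℂ} (hβ : IsDrivingFamily P β) {c : ℝ≥0} (hc : c ≠ 0) :
    IsDrivingFamily P (scaleNoise c β) where
  measurable m t := by
    have := hβ.measurable m ((c ^ 2)⁻¹ * t)
    unfold StochNS.scaleNoise
    fun_prop
  reality m t ω j := by
    simp [StochNS.scaleNoise, hβ.reality]
  brownian m hm j b := by
    have h := (hβ.brownian m hm j b).smul (c := (c ^ 2)⁻¹) (by positivity)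
    have hs : (√(((c ^ 2)⁻¹ : ℝ≥0) : ℝ))⁻¹ = c := by
      rw [NNReal.coe_inv, Real.sqrt_inv, inv_inv, NNReal.coe_pow]
      exact Real.sqrt_sq c.coe_nonneg
    rw [hs] at h
    convert h using 3 with t ω
    rw [StochNS.scaleNoise, part_real_mul]
    ring
  indep S hS := by
    have h := (hβ.indep S hS).comp (fun _ (f : ℝ≥0 → ℝ) (t : ℝ≥0) => (c : ℝ) * f ((c ^ 2)⁻¹ * t))
      fun _ => by fun_prop
    convert h using 3 with i ω
    ext t
    simp [StochNS.scaleNoise, part_real_mul]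

lemma IsGalerkinSolution.scale {σ : Mode → Matrix (Fin 3) (Fin 3) ℂ} {L L' ν ν' : PosReal}
    {n : ℕ} {Ω : Type} [MeasurableSpace Ω] {P : Measure Ω} {β : Mode → ℝ≥0 → Ω → Fin 3 → ℂ}
    {u : ℝ≥0 → Ω → H L} (hu : IsGalerkinSolution σ ν n P β u) {c : ℝ≥0} (hc : (c : ℝ) ≠ 0)
    (hL : (L' : ℝ) = (c : ℝ) ^ 3 * L) (hν : (ν' : ℝ) = (c : ℝ) ^ 4 * ν) :
    IsGalerkinSolution σ ν' n P (scaleNoise c β)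
      fun t ω => scaleHomeo hc L L' (u ((c ^ 2)⁻¹ * t) ω) where
  measurable t := (scaleHomeo hc L L').continuous.measurable.comp (hu.measurable _)
  continuous := by
    filter_upwards [hu.continuous] with ω h
    exact (scaleHomeo hc L L').continuous.comp (h.comp (continuous_const_mul _))
  galerkin := by
    filter_upwards [hu.galerkin] with ω h t m hm
    rw [coe_scaleHomeo, fourierCoeffVec_scaleL2, h _ m hm, smul_zero]
  equation := by
    filter_upwards [hu.equation] with ω h t m hm
    have hpos : 0 < (c : ℝ) := lt_of_le_of_ne c.2 hc.symm
    -- The change of time contributes `c²` and the drift `c⁻¹`, leaving the factor `c` carried by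
    -- every other term of the equation.
    have hint : ∫ s in (0 : ℝ)..t, drift ν' n
          (scaleHomeo hc L L' (u ((c ^ 2)⁻¹ * s.toNNReal) ω) : L2 L') m
        = (c : ℝ) • ∫ s in (0 : ℝ)..((c ^ 2)⁻¹ * t : ℝ≥0),
          drift ν n (u s.toNNReal ω : L2 L) m := by
      have hs := intervalIntegral.smul_integral_comp_mul_left (a := 0) (b := (t : ℝ))
        (fun s : ℝ => drift ν n (u s.toNNReal ω : L2 L) m) (((c : ℝ) ^ 2)⁻¹)
      rw [mul_zero] at hs
      push_cast
      rw [← hs, smul_smul, ← intervalIntegral.integral_smul]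
      refine intervalIntegral.integral_congr fun s _ => ?_
      have ht : (c ^ 2)⁻¹ * s.toNNReal = (((c : ℝ) ^ 2)⁻¹ * s).toNNReal := by
        rw [Real.toNNReal_mul (by positivity)]
        congr 1
        rw [← NNReal.coe_pow, ← NNReal.coe_inv, Real.toNNReal_coe]
      simp only [coe_scaleHomeo]
      rw [drift_scaleL2 hpos hL hν, ht]
      congr 1
      field_simp
    have h' := congrArg (fun v => ((c : ℝ) : ℂ) • v) (h ((c ^ 2)⁻¹ * t) m hm)
    simp only [smul_add] at h'
    rw [hint, coe_scaleHomeo, coe_scaleHomeo, fourierCoeffVec_scaleL2, fourierCoeffVec_scaleL2,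
      mul_zero, ← Complex.coe_smul (c : ℝ), h', ← Matrix.mulVec_smul]
    rfl

lemma IsGalerkinInvariant.scaleLaw {σ : Mode → Matrix (Fin 3) (Fin 3) ℂ} {L L' ν ν' : PosReal}
    {n : ℕ} {μ : ProbabilityMeasure (H L)} (hμ : IsGalerkinInvariant σ ν n μ) {c : ℝ≥0}
    (hc : (c : ℝ) ≠ 0) (hL : (L' : ℝ) = (c : ℝ) ^ 3 * L) (hν : (ν' : ℝ) = (c : ℝ) ^ 4 * ν) :
    IsGalerkinInvariant σ ν' n (scaleLaw hc L L' μ) := by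
  obtain ⟨Ω, mΩ, P, hP, β, u, hβ, hu, hind, hlaw⟩ := hμ
  refine ⟨Ω, mΩ, P, hP, StochNS.scaleNoise c β, _, hβ.scaleNoise (by exact_mod_cast hc),
    hu.scale hc hL hν, ?_, fun t => ?_⟩
  · have h := hind.comp (φ := scaleHomeo hc L L')
      (ψ := fun (f : Mode → ℝ≥0 → Fin 3 → ℂ) (m : Mode) (t : ℝ≥0) (j : Fin 3) =>
        ((c : ℝ) : ℂ) * f m ((c ^ 2)⁻¹ * t) j)
      (scaleHomeo hc L L').continuous.measurable (by fun_prop)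
    -- Time `0` is fixed by the rescaling, so the new initial condition is a function of the old one
    -- alone.
    rw [mul_zero]
    exact h
  · rw [toMeasure_scaleLaw, ← hlaw ((c ^ 2)⁻¹ * t),
      Measure.map_map (MeasurableEquiv.measurable _) (hu.measurable _)]
    rfl

theorem scaleLaw_mem_galerkinLimit {σ : Mode → Matrix (Fin 3) (Fin 3) ℂ} {L L' ν ν' : PosReal}
    {μ : ProbabilityMeasure (H L)} (hμ : μ ∈ galerkinLimit σ ν L) {c : ℝ≥0} (hc : (c : ℝ) ≠ 0)
    (hL : (L' : ℝ) = (c : ℝ) ^ 3 * L) (hν : (ν' : ℝ) = (c : ℝ) ^ 4 * ν) :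
    scaleLaw hc L L' μ ∈ galerkinLimit σ ν' L' := by
  obtain ⟨k, m, hk, hm, hlim⟩ := hμ
  exact ⟨k, fun j => scaleLaw hc L L' (m j), hk,
    fun j => ⟨(hm j).1.scaleLaw hc L', (hm j).2.scaleLaw hc hL hν⟩,
    ((continuous_scaleLaw hc L L').tendsto μ).comp hlim⟩

/-! ### Bounds on the structure function under rescaling -/

lemma ofReal_mul_le_iff {a k : ℝ} (hk : 0 < k) {S : ℝ≥0∞} :
    ENNReal.ofReal (a * k) ≤ ENNReal.ofReal k * S ↔ ENNReal.ofReal a ≤ S := by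
  rw [mul_comm a, ENNReal.ofReal_mul hk.le]
  exact ENNReal.mul_le_mul_iff_right (by simpa using hk) ENNReal.ofReal_ne_top

lemma le_ofReal_mul_iff {a k : ℝ} (hk : 0 < k) {S : ℝ≥0∞} :
    ENNReal.ofReal k * S ≤ ENNReal.ofReal (a * k) ↔ S ≤ ENNReal.ofReal a := by
  rw [mul_comm a, ENNReal.ofReal_mul hk.le]
  exact ENNReal.mul_le_mul_iff_right (by simpa using hk) ENNReal.ofReal_ne_top

/-- All Galerkin limits of viscosity `ν` on the torus of side `L` have their structure function
at `r` between `a` and `b`. -/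
def StructureBounds (σ : Mode → Matrix (Fin 3) (Fin 3) ℂ) (i : Fin 3) (ν L : PosReal)
    (r a b : ℝ) : Prop :=
  ∀ μ ∈ galerkinLimit σ ν L,
    ENNReal.ofReal a ≤ structureFun i μ r ∧ structureFun i μ r ≤ ENNReal.ofReal b

/-- Bounds are pulled back: each limit at `(ν, L)` is pushed to one at `(ν', L')`, so only one
inclusion between the sets of limits is needed. -/
lemma StructureBounds.rescale {σ : Mode → Matrix (Fin 3) (Fin 3) ℂ} {i : Fin 3}
    {ν ν' L L' : PosReal} {r a b : ℝ} {c : ℝ≥0} (hc : (c : ℝ) ≠ 0)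
    (hL : (L' : ℝ) = (c : ℝ) ^ 3 * L) (hν : (ν' : ℝ) = (c : ℝ) ^ 4 * ν)
    (h : StructureBounds σ i ν' L' r (a * (c : ℝ) ^ 2) (b * (c : ℝ) ^ 2)) :
    StructureBounds σ i ν L (r * ((L' : ℝ)⁻¹ * L)) a b := by
  intro μ hμ
  have h' := h _ (scaleLaw_mem_galerkinLimit hμ hc hL hν)
  rw [structureFun_scaleLaw, ofReal_mul_le_iff (by positivity),
    le_ofReal_mul_iff (by positivity)] at h'
  exact h'

/-- The bounds of Condition A at `(ν', L)` are those of the K41 law at `ν = L^{-4/3} ν'`,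
`r = 1 / L`. -/
theorem structureBounds_iff {σ : Mode → Matrix (Fin 3) (Fin 3) ℂ} {i : Fin 3}
    {ν ν' L : PosReal} {r : ℝ} (hr : r = (L : ℝ)⁻¹)
    (hν : (ν' : ℝ) = (L : ℝ) ^ (4 / 3 : ℝ) * ν) (a b : ℝ) :
    StructureBounds σ i ν' L 1 a b ↔
      StructureBounds σ i ν 1 r (a * r ^ (2 / 3 : ℝ)) (b * r ^ (2 / 3 : ℝ)) := by
  have hL := L.2
  have hc : 0 < (L : ℝ) ^ (1 / 3 : ℝ) := Real.rpow_pos_of_pos hL _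
  have hpow : ∀ k : ℕ, ((L : ℝ) ^ (1 / 3 : ℝ)) ^ k = (L : ℝ) ^ (k / 3 : ℝ) := fun k => by
    rw [← Real.rpow_natCast, ← Real.rpow_mul hL.le]
    congr 1
    ring
  have h2 := hpow 2
  have h3 := hpow 3
  have h4 := hpow 4
  norm_num at h2 h3 h4 hc
  have hr2 : r ^ (2 / 3 : ℝ) = (((L : ℝ) ^ (1 / 3 : ℝ)) ^ 2)⁻¹ := by
    rw [h2, hr, Real.inv_rpow hL.le]
  rw [hr2]
  rw [← h4] at hν
  -- From here on `c` enters only through its integer powers `c² = L^{2/3}`, `c³ = L`, `c⁴ =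
  -- L^{4/3}`.
  generalize (L : ℝ) ^ (1 / 3 : ℝ) = c at *
  lift c to ℝ≥0 using hc.le
  have hc0 : (c : ℝ) ≠ 0 := hc.ne'
  constructor <;> intro h
  · have := StructureBounds.rescale (a := a * ((c : ℝ) ^ 2)⁻¹) (b := b * ((c : ℝ) ^ 2)⁻¹) (r := 1)
      (L := 1) (L' := L) (ν := ν) (ν' := ν') hc0 (by simp [h3]) hν
      (by simpa [mul_assoc, hc0] using h)
    simpa [hr] using this
  -- The inverse rescaling, with factor `c⁻¹`, leads from side `L` back to the unit torus.
  · have := StructureBounds.rescale (a := a) (b := b) (r := r) (L := L) (L' := 1) (ν := ν')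
      (ν' := ν) (c := c⁻¹) (by simpa using hc0)
      (by rw [← h3]; push_cast; field_simp; simp) (by rw [hν]; push_cast; field_simp)
      (by simpa using h)
    simpa [hr, hL.ne'] using this

lemma conditionA_iff (σ : Mode → Matrix (Fin 3) (Fin 3) ℂ) (i : Fin 3) :
    ConditionA i (triplesNS σ) ↔
      ∃ (ν₀ : ℝ) (R₀ : ℝ → ℝ) (c C : ℝ), (0 < ν₀ ∧ StrictAntiOn R₀ (Set.Ioc 0 ν₀) ∧
        (∀ ν ∈ Set.Ioc 0 ν₀, 1 ≤ R₀ ν) ∧ Tendsto R₀ (𝓝[>] 0) atTop) ∧ 0 < c ∧ c < C ∧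
        ∀ ν L : PosReal, (ν : ℝ) < ν₀ → R₀ ν < L → StructureBounds σ i ν L 1 c C := by
  constructor
  · rintro ⟨D, c, C, ⟨ν₀, R₀, h1, h2, h3, h4, rfl⟩, hc, hC, h⟩
    exact ⟨ν₀, R₀, c, C, ⟨h1, h2, h3, h4⟩, hc, hC,
      fun ν L hν hL μ hμ => h ⟨L, ν, μ⟩ hμ ⟨hν, hL⟩⟩
  · rintro ⟨ν₀, R₀, c, C, ⟨h1, h2, h3, h4⟩, hc, hC, h⟩
    exact ⟨_, c, C, ⟨ν₀, R₀, h1, h2, h3, h4, rfl⟩, hc, hC,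
      fun τ hτ hD => h τ.ν τ.L hD.1 hD.2 τ.μ hτ⟩

/-! ### Conversion between the two kinds of regions -/

lemma rpow_neg_cancel {x : ℝ} (hx : 0 < x) {s t : ℝ} (hst : s * t = 1) :
    (x ^ (-s)) ^ (-t) = x := by
  rw [← Real.rpow_mul hx.le, neg_mul_neg, hst, Real.rpow_one]

/-- At `r = q ν^{3/4}` and `L = 1/r` the rescaled viscosity depends on `q` only. -/
lemma inv_rpow_mul_eq {q ν : ℝ} (hq : 0 < q) (hν : 0 < ν) :
    ((q * ν ^ (3 / 4 : ℝ))⁻¹) ^ (4 / 3 : ℝ) * ν = q ^ (-(4 / 3) : ℝ) := by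
  rw [Real.inv_rpow (by positivity), Real.mul_rpow hq.le (by positivity), ← Real.rpow_mul hν.le,
    Real.rpow_neg hq.le]
  norm_num
  field_simp

theorem isK41_of_conditionA {σ : Mode → Matrix (Fin 3) (Fin 3) ℂ} {i : Fin 3}
    (hA : ConditionA i (triplesNS σ)) : IsK41 i (pairsNS σ) := by
  obtain ⟨ν₀, R, c, C, ⟨hν₀, hanti, hone, -⟩, hc, hC, h⟩ := (conditionA_iff σ i).1 hA
  set C₀ : ℝ := ν₀ ^ (-(3 / 4) : ℝ) with hC₀
  have hC₀pos : 0 < C₀ := Real.rpow_pos_of_pos hν₀ _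
  have hmem : ∀ {a : ℝ}, C₀ ≤ a → a ^ (-(4 / 3) : ℝ) ∈ Set.Ioc 0 ν₀ := by
    intro a ha
    have ha0 := hC₀pos.trans_le ha
    refine ⟨Real.rpow_pos_of_pos ha0 _, ?_⟩
    rw [← rpow_neg_cancel hν₀ (by norm_num : (3 / 4 : ℝ) * (4 / 3) = 1)]
    exact Real.rpow_le_rpow_of_nonpos hC₀pos ha (by norm_num)
  -- The condition `R ν' < L` reads `G q < ν^{-3/4}` in the variable `q`, so the upper end of the
  -- inertial range is a generalised inverse of `G` at `ν^{-3/4}`.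
  set G : ℝ → ℝ := fun a => a * R (a ^ (-(4 / 3) : ℝ)) with hG
  have hGle : ∀ {a : ℝ}, C₀ ≤ a → a ≤ G a := fun {a} ha =>
    le_mul_of_one_le_right (hC₀pos.le.trans ha) (hone _ (hmem ha))
  set s : ℝ → Set ℝ := fun ν => {a | C₀ ≤ a ∧ G a ≤ ν ^ (-(3 / 4) : ℝ)} with hs
  have hbdd : ∀ ν, BddAbove (s ν) := fun ν => ⟨ν ^ (-(3 / 4) : ℝ), fun a ha =>
    (hGle ha.1).trans ha.2⟩
  have hG2 : 0 < G (2 * C₀) := by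
    have := hGle (a := 2 * C₀) (by linarith)
    linarith
  have hne : ∀ ν ∈ Set.Ioc 0 (G (2 * C₀) ^ (-(4 / 3) : ℝ)), 2 * C₀ ∈ s ν := by
    intro ν hν
    refine ⟨by linarith, ?_⟩
    rw [← rpow_neg_cancel hG2 (by norm_num : (4 / 3 : ℝ) * (3 / 4) = 1)]
    exact Real.rpow_le_rpow_of_nonpos hν.1 hν.2 (by norm_num)
  -- The viscosity threshold puts `2 * C₀` into every `s ν`, which makes the supremum strictly
  -- larger than `C₀`.
  refine ⟨G (2 * C₀) ^ (-(4 / 3) : ℝ), c, C, C₀, fun ν => sSup (s ν),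
    Real.rpow_pos_of_pos hG2 _, hc, hC, hC₀pos, ?_, ?_, ?_, ?_⟩
  · intro x hx y hy hxy
    exact csSup_le_csSup (hbdd x) ⟨_, hne y hy⟩ fun a ha =>
      ⟨ha.1, ha.2.trans (Real.rpow_le_rpow_of_nonpos hx.1 hxy (by norm_num))⟩
  · intro ν hν
    have := le_csSup (hbdd ν) (hne ν hν)
    linarith
  · refine tendsto_atTop.2 fun b => ?_
    have hlim : Tendsto (fun ν : ℝ => ν ^ (-(3 / 4) : ℝ)) (𝓝[>] 0) atTop :=
      tendsto_rpow_neg_nhdsGT_zero (by norm_num)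
    filter_upwards [hlim.eventually_ge_atTop (G (max b C₀))] with ν hν
    exact (le_max_left _ _).trans (le_csSup (hbdd ν) ⟨le_max_right _ _, hν⟩)
  · rintro ⟨μ, ν⟩ hμ hle r hr1 hr2
    have hν : 0 < (ν : ℝ) := ν.2
    have hw : 0 < (ν : ℝ) ^ (3 / 4 : ℝ) := Real.rpow_pos_of_pos hν _
    obtain ⟨q, rfl⟩ : ∃ q, r = q * (ν : ℝ) ^ (3 / 4 : ℝ) := ⟨r / _, (div_mul_cancel₀ _ hw.ne').symm⟩
    have hq1 : C₀ < q := lt_of_mul_lt_mul_right hr1 hw.le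
    have hq2 : q < sSup (s ν) := by
      rw [mul_comm] at hr2
      exact lt_of_mul_lt_mul_left hr2 hw.le
    have hq := hC₀pos.trans hq1
    -- The supremum need not be attained; a point `a > q` of the set suffices, since `R` is
    -- decreasing.
    obtain ⟨a, ha, hqa⟩ := exists_lt_of_lt_csSup ⟨_, hne ν ⟨hν, hle⟩⟩ hq2
    have hL : 0 < (q * (ν : ℝ) ^ (3 / 4 : ℝ))⁻¹ := by positivity
    have key := inv_rpow_mul_eq hq hν
    have hb := h ⟨q ^ (-(4 / 3) : ℝ), Real.rpow_pos_of_pos hq _⟩ ⟨_, hL⟩ ?_ ?_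
    · exact (structureBounds_iff (inv_inv _).symm key.symm c C).1 hb μ hμ
    · change q ^ (-(4 / 3) : ℝ) < ν₀
      rw [← rpow_neg_cancel hν₀ (by norm_num : (3 / 4 : ℝ) * (4 / 3) = 1)]
      exact Real.rpow_lt_rpow_of_neg hC₀pos hq1 (by norm_num)
    · change R (q ^ (-(4 / 3) : ℝ)) < (q * (ν : ℝ) ^ (3 / 4 : ℝ))⁻¹
      have hlt := hanti (hmem ha.1) (hmem hq1.le)
        (Real.rpow_lt_rpow_of_neg hq hqa (by norm_num))
      refine hlt.trans ?_
      have ha0 := hq.trans hqa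
      have h1 : R (a ^ (-(4 / 3) : ℝ)) ≤ (a * (ν : ℝ) ^ (3 / 4 : ℝ))⁻¹ := by
        have h2 := ha.2
        rw [Real.rpow_neg hν.le] at h2
        rw [mul_inv, ← div_eq_inv_mul, le_div_iff₀ ha0, mul_comm]
        exact h2
      exact h1.trans_lt (inv_strictAnti₀ (by positivity) (by gcongr))

theorem conditionA_of_isK41 {σ : Mode → Matrix (Fin 3) (Fin 3) ℂ} {i : Fin 3}
    (hK : IsK41 i (pairsNS σ)) : ConditionA i (triplesNS σ) := by
  obtain ⟨ν₀, c, C, C₀, R, hν₀, hc, hC, hC₀, hanti, -, hlim, h⟩ := hK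
  set K : ℝ := C₀ ^ (-(4 / 3) : ℝ) with hKdef
  have hKpos : 0 < K := Real.rpow_pos_of_pos hC₀ _
  set s : ℝ → Set ℝ := fun a => {ν | ν ∈ Set.Ioc 0 ν₀ ∧ a < R ν} with hs
  have hne : ∀ a, (s a).Nonempty := fun a => by
    have h2 : ∀ᶠ ν in 𝓝[>] (0 : ℝ), ν ∈ Set.Ioc 0 ν₀ := Ioc_mem_nhdsGT hν₀
    exact (h2.and (hlim.eventually_gt_atTop a)).exists
  have hbdd : ∀ a, BddAbove (s a) := fun a => ⟨ν₀, fun ν hν => hν.1.2⟩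
  have hpos : ∀ a, 0 < sSup (s a) := fun a => by
    obtain ⟨ν, hν⟩ := hne a
    exact hν.1.1.trans_le (le_csSup (hbdd a) hν)
  have hge : ∀ x : ℝ, x⁻¹ + 1 ≤ K / sSup (s (x ^ (-(3 / 4) : ℝ))) + 1 + x⁻¹ := fun x => by
    have := (div_pos hKpos (hpos (x ^ (-(3 / 4) : ℝ)))).le
    linarith
  -- The first summand forces `ν` below the supremum of viscosities whose inertial range reaches
  -- past `q`. The summand `1` gives `L ≥ 1`, hence `L ≤ L^{4/3}`. The summand `x⁻¹` supplies strict
  -- monotonicity and divergence at `0`, since the first is only weakly monotone.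
  refine (conditionA_iff σ i).2 ⟨K, fun x => K / sSup (s (x ^ (-(3 / 4) : ℝ))) + 1 + x⁻¹, c, C,
    ⟨hKpos, ?_, ?_, ?_⟩, hc, hC, ?_⟩
  · intro x hx y hy hxy
    have h1 : y⁻¹ < x⁻¹ := inv_strictAnti₀ hx.1 hxy
    have h2 : sSup (s (x ^ (-(3 / 4) : ℝ))) ≤ sSup (s (y ^ (-(3 / 4) : ℝ))) :=
      csSup_le_csSup (hbdd _) (hne _) fun ν hν =>
        ⟨hν.1, (Real.rpow_le_rpow_of_nonpos hx.1 hxy.le (by norm_num)).trans_lt hν.2⟩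
    have h3 := div_le_div_of_nonneg_left hKpos.le (hpos _) h2
    simp only
    linarith
  · intro x hx
    have := inv_pos.2 hx.1
    linarith [hge x]
  · exact tendsto_atTop_mono hge (tendsto_atTop_add_const_right _ _ tendsto_inv_nhdsGT_zero)
  · intro ν' L hν' hL
    have hν'pos : 0 < (ν' : ℝ) := ν'.2
    have hLpos : 0 < (L : ℝ) := L.2
    set q : ℝ := (ν' : ℝ) ^ (-(3 / 4) : ℝ) with hqdef
    have hq : 0 < q := Real.rpow_pos_of_pos hν'pos _
    have hδ := hpos q
    have hinv := inv_pos.2 hν'pos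
    have hdiv := div_pos hKpos hδ
    have hL43 : (L : ℝ) ≤ (L : ℝ) ^ (4 / 3 : ℝ) := by
      simpa using Real.rpow_le_rpow_of_exponent_le (x := (L : ℝ)) (y := 1) (z := 4 / 3)
        (by linarith) (by norm_num)
    have hL43pos : 0 < (L : ℝ) ^ (4 / 3 : ℝ) := hLpos.trans_le hL43
    let ν : PosReal := ⟨ν' / (L : ℝ) ^ (4 / 3 : ℝ), div_pos hν'pos hL43pos⟩
    have hνval : (ν : ℝ) = ν' / (L : ℝ) ^ (4 / 3 : ℝ) := rfl
    have hνδ : (ν : ℝ) < sSup (s q) := by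
      -- Together with `ν' < K`, this yields `ν = ν' / L^{4/3} < sSup (s q)`.
      have h1 : K / sSup (s q) < (L : ℝ) ^ (4 / 3 : ℝ) := by linarith
      rw [div_lt_iff₀ hδ] at h1
      rw [hνval, div_lt_iff₀ hL43pos]
      linarith
    obtain ⟨x, hx, hνx⟩ := exists_lt_of_lt_csSup (hne q) hνδ
    have hνmem : (ν : ℝ) ∈ Set.Ioc 0 ν₀ := ⟨ν.2, hνx.le.trans hx.1.2⟩
    have hqR : q < R ν := hx.2.trans_le (hanti hνmem hx.1 hνx.le)
    have hw : 0 < (ν : ℝ) ^ (3 / 4 : ℝ) := Real.rpow_pos_of_pos ν.2 _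
    have hr : q * (ν : ℝ) ^ (3 / 4 : ℝ) = (L : ℝ)⁻¹ := by
      rw [hνval, Real.div_rpow hν'pos.le hL43pos.le, ← Real.rpow_mul hLpos.le, hqdef,
        Real.rpow_neg hν'pos.le]
      have : (ν' : ℝ) ^ (3 / 4 : ℝ) ≠ 0 := (Real.rpow_pos_of_pos hν'pos _).ne'
      norm_num
      field_simp
    have hC₀q : C₀ < q := by
      rw [← rpow_neg_cancel hC₀ (by norm_num : (4 / 3 : ℝ) * (3 / 4) = 1)]
      exact Real.rpow_lt_rpow_of_neg hν'pos hν' (by norm_num)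
    refine (structureBounds_iff (ν := ν) hr (by rw [hνval]; field_simp) c C).2 fun μ hμ => ?_
    refine h (μ, ν) hμ hνmem.2 _ ?_ ?_
    · exact mul_lt_mul_of_pos_right hC₀q hw
    · rw [mul_comm]
      exact mul_lt_mul_of_pos_left hqR hw

end StochNS

end

theorem mainTheorem2 (σ : StochNS.Mode → Matrix (Fin 3) (Fin 3) ℂ)
    (hσ : StochNS.IsNoiseCoeff σ) (i : Fin 3) :
    StochNS.ConditionA i (StochNS.triplesNS σ) ↔ StochNS.IsK41 i (StochNS.pairsNS σ) :=
  ⟨StochNS.isK41_of_conditionA, StochNS.conditionA_of_isK41⟩
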